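/- Let $G$ be the Heisenberg group of real matrices $\begin{pmatrix}1&a&c\\0&1&b\\0&0&1\end{pmatrix}$, with the left-invariant sub-Riemannian structure whose orthonormal frame is $X_1=\partial_a$, $X_2=\partial_b+a\,\partial_c$ (in the coordinates $x=a$, $y=b$, $z=c-\frac{ab}{2}$: $X_1=\partial_x-\frac y2\partial_z$, $X_2=\partial_y+\frac x2\partial_z$). Let $H\subset G$ be the subgroup of integer matrices, $M=\{Hg\mid g\in G\}$ the Heisenberg nil-manifold, $\pi:G\to M$, $g\mapsto Hg$, the projection, and give $M$ the sub-Riemannian structure with the orthonormal frame $\pi_*X_1,\pi_*X_2$. The cut time of a curve $q(\cdot)$ defined on an interval $J$ with least element $0$ is $$t_{\mathrm{cut}}(q(\cdot))=\sup\{\tau\in J,\ \tau>0\mid q|_{[0,\tau]}\text{ is a sub-Riemannian length minimizer}\}\in[0,+\infty]$$ (with $\sup\emptyset=0$). Let $B_t(g)\subset G$ be the closed sub-Riemannian ball of radius $t$ centred at $g$, and $$\hat t=\sup\{t>0\mid B_t(h_1)\cap B_t(h_2)=\emptyset\ \text{ for all } h_1\ne h_2\in H\}.$$ Then $\hat t=\frac12$.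 Moreover, let $J$ be an interval with least element $0$ (for instance $[0,T]$ or $[0,\infty)$), let $g:J\to G$ be a sub-Riemannian geodesic parametrized by arc length (a horizontal curve of unit speed whose sufficiently short arcs are length minimizers) with $g(0)=\mathrm{Id}$, and let $g'=\pi\circ g$. Then: (1) $t_{\mathrm{cut}}(g'(\cdot))\le t_{\mathrm{cut}}(g(\cdot))$. (2) If $t_{\mathrm{cut}}(g(\cdot))\ge\hat t$, then $\hat t\le t_{\mathrm{cut}}(g'(\cdot))\le t_{\mathrm{cut}}(g(\cdot))$. (3) If $t_{\mathrm{cut}}(g(\cdot))<\hat t$, then $t_{\mathrm{cut}}(g'(\cdot))=t_{\mathrm{cut}}(g(\cdot))$. -/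

import Mathlib

open Set MeasureTheory Topology Manifold
open scoped ENNReal NNReal ContDiff

noncomputable section

/-! ### Sub-Riemannian geometry on a manifold with a given orthonormal frame -/

namespace SubRiemannian

section

variable {E : Type*} [NormedAddCommGroup E] [NormedSpace ℝ E]
  {M : Type*} [TopologicalSpace M] [ChartedSpace E M] {k : ℕ}

/-- The vectors of the distribution `D_q = span (X_1(q), …, X_k(q))`. -/
def distribution (X : Fin k → (q : M) → TangentSpace 𝓘(ℝ, E) q) (q : M) :
    Submodule ℝ (TangentSpace 𝓘(ℝ, E) q) :=
  Submodule.span ℝ (range fun i => X i q)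

/-- The norm on `D_q` of the inner product for which `X_1(q), …, X_k(q)` is orthonormal:
`‖v‖ = (u_1² + … + u_k²)^{1/2}` if `v = u_1 X_1(q) + … + u_k X_k(q)`. (The infimum is over a single
number if the frame is linearly independent and `v ∈ D_q`.) -/
def frameNorm (X : Fin k → (q : M) → TangentSpace 𝓘(ℝ, E) q) (q : M)
    (v : TangentSpace 𝓘(ℝ, E) q) : ℝ :=
  sInf {r : ℝ | ∃ u : Fin k → ℝ, v = ∑ i, u i • X i q ∧ r = √(∑ i, u i ^ 2)}

/-- The velocity of a curve at time `t`. -/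
def velocity (γ : ℝ → M) (t : ℝ) : TangentSpace 𝓘(ℝ, E) (γ t) :=
  mfderiv 𝓘(ℝ, ℝ) 𝓘(ℝ, E) γ t (1 : ℝ)

/-- The restriction of `γ` to the compact interval `[s, t]` is Lipschitz (that is, continuous and
Lipschitz in charts). -/
def IsLipschitzCurve (E : Type*) [NormedAddCommGroup E] [NormedSpace ℝ E]
    {M : Type*} [TopologicalSpace M] [ChartedSpace E M] (γ : ℝ → M) (s t : ℝ) : Prop :=
  ContinuousOn γ (Icc s t) ∧
    ∀ r ∈ Icc s t, ∃ K : ℝ≥0, ∃ U ∈ 𝓝[Icc s t] r,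
      LipschitzOnWith K (fun r' => extChartAt 𝓘(ℝ, E) (γ r) (γ r')) U

/-- The restriction of `γ` to `[s, t]` is a horizontal curve. -/
structure IsHorizontal (X : Fin k → (q : M) → TangentSpace 𝓘(ℝ, E) q) (γ : ℝ → M) (s t : ℝ) :
    Prop where
  lipschitz : IsLipschitzCurve E γ s t
  ae_mem : ∀ᵐ r ∂(volume.restrict (Icc s t)),
    MDifferentiableAt 𝓘(ℝ, ℝ) 𝓘(ℝ, E) γ r ∧ velocity γ r ∈ distribution X (γ r)

/-- The sub-Riemannian length of the restriction of a horizontal curve to `[s, t]`. -/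
def length (X : Fin k → (q : M) → TangentSpace 𝓘(ℝ, E) q) (γ : ℝ → M) (s t : ℝ) : ℝ≥0∞ :=
  ∫⁻ r in Icc s t, ENNReal.ofReal (frameNorm X (γ r) (velocity γ r))

/-- The sub-Riemannian distance (`∞` if the points cannot be joined by a horizontal curve). -/
def dist (X : Fin k → (q : M) → TangentSpace 𝓘(ℝ, E) q) (p q : M) : ℝ≥0∞ :=
  sInf {l : ℝ≥0∞ | ∃ (γ : ℝ → M) (T : ℝ), 0 ≤ T ∧ IsHorizontal X γ 0 T ∧ γ 0 = p ∧ γ T = q ∧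
    l = length X γ 0 T}

/-- The closed sub-Riemannian ball of radius `t`. -/
def ball (X : Fin k → (q : M) → TangentSpace 𝓘(ℝ, E) q) (t : ℝ) (p : M) : Set M :=
  {q | dist X p q ≤ ENNReal.ofReal t}

/-- The restriction of `γ` to `[s, t]` is a sub-Riemannian length minimizer. -/
def IsLengthMinimizer (X : Fin k → (q : M) → TangentSpace 𝓘(ℝ, E) q) (γ : ℝ → M) (s t : ℝ) :
    Prop :=
  IsHorizontal X γ s t ∧ length X γ s t = dist X (γ s) (γ t)

/-- `γ` is a sub-Riemannian geodesic on the interval `J`: a horizontal curve whose sufficiently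
short arcs are length minimizers. -/
structure IsGeodesic (X : Fin k → (q : M) → TangentSpace 𝓘(ℝ, E) q) (γ : ℝ → M) (J : Set ℝ) :
    Prop where
  horizontal : ∀ s ∈ J, ∀ t ∈ J, s ≤ t → IsHorizontal X γ s t
  locally_minimizing : ∀ r ∈ J, ∃ ε > 0, ∀ s ∈ J, ∀ t ∈ J,
    r - ε ≤ s → s ≤ t → t ≤ r + ε → IsLengthMinimizer X γ s t

/-- `γ` is parametrized by arc length on `J`. -/
def IsArcLength (X : Fin k → (q : M) → TangentSpace 𝓘(ℝ, E) q) (γ : ℝ → M) (J : Set ℝ) : Prop :=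
  ∀ᵐ r ∂(volume.restrict J), frameNorm X (γ r) (velocity γ r) = 1

/-- The cut time, in `[0, ∞]`, of a curve `γ` defined on the interval `J` with left end `0`. -/
def cutTime (X : Fin k → (q : M) → TangentSpace 𝓘(ℝ, E) q) (γ : ℝ → M) (J : Set ℝ) : ℝ≥0∞ :=
  sSup {τ : ℝ≥0∞ | ∃ t ∈ J, 0 < t ∧ IsLengthMinimizer X γ 0 t ∧ τ = ENNReal.ofReal t}

end

end SubRiemannian

/-! ### The Heisenberg group -/

/-- The Heisenberg group, in the coordinates `(a, b, c)` of the matrix with rows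
`(1, a, c)`, `(0, 1, b)`, `(0, 0, 1)`. The coordinates make it a smooth manifold. -/
def Heis : Type := ℝ × ℝ × ℝ

namespace Heis

instance : NormedAddCommGroup Heis := inferInstanceAs (NormedAddCommGroup (ℝ × ℝ × ℝ))
instance : NormedSpace ℝ Heis := inferInstanceAs (NormedSpace ℝ (ℝ × ℝ × ℝ))
instance : FiniteDimensional ℝ Heis := inferInstanceAs (FiniteDimensional ℝ (ℝ × ℝ × ℝ))
instance : LocallyCompactSpace Heis := inferInstanceAs (LocallyCompactSpace (ℝ × ℝ × ℝ))

/-- The element with coordinates `(a, b, c)`. -/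
def mk (a b c : ℝ) : Heis := (a, b, c)

/-- The matrix entry `a`. -/
def a (g : Heis) : ℝ := g.1
/-- The matrix entry `b`. -/
def b (g : Heis) : ℝ := g.2.1
/-- The matrix entry `c`. -/
def c (g : Heis) : ℝ := g.2.2

@[simp] theorem a_mk (a b c : ℝ) : (mk a b c).a = a := rfl
@[simp] theorem b_mk (a b c : ℝ) : (mk a b c).b = b := rfl
@[simp] theorem c_mk (a b c : ℝ) : (mk a b c).c = c := rfl

@[ext] theorem ext {g h : Heis} (h1 : g.a = h.a) (h2 : g.b = h.b) (h3 : g.c = h.c) : g = h :=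
  Prod.ext h1 (Prod.ext h2 h3)

instance : Mul Heis := ⟨fun g h => mk (g.a + h.a) (g.b + h.b) (g.c + h.c + g.a * h.b)⟩
instance : One Heis := ⟨mk 0 0 0⟩
instance : Inv Heis := ⟨fun g => mk (-g.a) (-g.b) (-g.c + g.a * g.b)⟩

@[simp] theorem mul_a (g h : Heis) : (g * h).a = g.a + h.a := rfl
@[simp] theorem mul_b (g h : Heis) : (g * h).b = g.b + h.b := rfl
@[simp] theorem mul_c (g h : Heis) : (g * h).c = g.c + h.c + g.a * h.b := rfl
@[simp] theorem one_a : (1 : Heis).a = 0 := rfl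
@[simp] theorem one_b : (1 : Heis).b = 0 := rfl
@[simp] theorem one_c : (1 : Heis).c = 0 := rfl
@[simp] theorem inv_a (g : Heis) : (g⁻¹).a = -g.a := rfl
@[simp] theorem inv_b (g : Heis) : (g⁻¹).b = -g.b := rfl
@[simp] theorem inv_c (g : Heis) : (g⁻¹).c = -g.c + g.a * g.b := rfl

instance : Group Heis :=
  Group.ofLeftAxioms
    (fun g h k => by ext <;> simp <;> ring)
    (fun g => by ext <;> simp)
    (fun g => by ext <;> simp)

/-- The matrix of an element; the group law is matrix multiplication. -/
def toMatrix (g : Heis) : Matrix (Fin 3) (Fin 3) ℝ :=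
  !![1, g.a, g.c; 0, 1, g.b; 0, 0, 1]

theorem toMatrix_mul (g h : Heis) : (g * h).toMatrix = g.toMatrix * h.toMatrix := by
  ext i j
  fin_cases i <;> fin_cases j <;> simp [toMatrix, Matrix.mul_apply, Fin.sum_univ_three] <;> ring

theorem contDiff_a : ContDiff ℝ ∞ a := contDiff_fst (E := ℝ) (F := ℝ × ℝ)
theorem contDiff_b : ContDiff ℝ ∞ b :=
  (contDiff_fst (E := ℝ) (F := ℝ)).comp (contDiff_snd (E := ℝ) (F := ℝ × ℝ))
theorem contDiff_c : ContDiff ℝ ∞ c :=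
  (contDiff_snd (E := ℝ) (F := ℝ)).comp (contDiff_snd (E := ℝ) (F := ℝ × ℝ))

theorem contDiff_mk {F : Type*} [NormedAddCommGroup F] [NormedSpace ℝ F] {p q r : F → ℝ}
    (hp : ContDiff ℝ ∞ p) (hq : ContDiff ℝ ∞ q) (hr : ContDiff ℝ ∞ r) :
    ContDiff ℝ ∞ fun x => mk (p x) (q x) (r x) :=
  hp.prodMk (hq.prodMk hr)

theorem continuous_mk {F : Type*} [TopologicalSpace F] {p q r : F → ℝ}
    (hp : Continuous p) (hq : Continuous q) (hr : Continuous r) :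
    Continuous fun x => mk (p x) (q x) (r x) :=
  hp.prodMk (hq.prodMk hr)

theorem contDiff_mul_left (h : Heis) : ContDiff ℝ ∞ fun g : Heis => h * g :=
  contDiff_mk (contDiff_const.add contDiff_a) (contDiff_const.add contDiff_b)
    ((contDiff_const.add contDiff_c).add (contDiff_const.mul contDiff_b))

instance : IsTopologicalGroup Heis where
  continuous_mul := by
    have ha := contDiff_a.continuous
    have hb := contDiff_b.continuous
    have hc := contDiff_c.continuous
    exact continuous_mk (by fun_prop) (by fun_prop) (by fun_prop)
  continuous_inv := by
    have ha := contDiff_a.continuous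
    have hb := contDiff_b.continuous
    have hc := contDiff_c.continuous
    exact continuous_mk (by fun_prop) (by fun_prop) (by fun_prop)

/-- The left-invariant orthonormal frame `X_1 = ∂/∂a`, `X_2 = ∂/∂b + a ∂/∂c`. In the coordinates
`x = a`, `y = b`, `z = c - ab/2` these are `X_1 = ∂/∂x - (y/2) ∂/∂z`,
`X_2 = ∂/∂y + (x/2) ∂/∂z`. -/
def X : Fin 2 → (g : Heis) → TangentSpace 𝓘(ℝ, Heis) g :=
  ![fun _ => mk 1 0 0, fun g => mk 0 1 g.a]

/-- The subgroup `H` of integer matrices. -/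
def intSubgroup : Subgroup Heis where
  carrier := {g | ∃ m n k : ℤ, g = mk m n k}
  mul_mem' := by
    rintro _ _ ⟨m, n, k, rfl⟩ ⟨m', n', k', rfl⟩
    exact ⟨m + m', n + n', k + k' + m * n', by ext <;> simp⟩
  one_mem' := ⟨0, 0, 0, by ext <;> simp⟩
  inv_mem' := by
    rintro _ ⟨m, n, k, rfl⟩
    exact ⟨-m, -n, -k + m * n, by ext <;> simp⟩

instance : ProperlyDiscontinuousSMul intSubgroup Heis := by
  apply Subgroup.properlyDiscontinuousSMul_of_tendsto_cofinite
  rw [Filter.tendsto_def]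
  intro s hs
  rw [Filter.mem_cocompact] at hs
  obtain ⟨K, hK, hKs⟩ := hs
  rw [Filter.mem_cofinite]
  obtain ⟨R, hR⟩ := hK.isBounded.exists_norm_le
  have hfin : (Icc (-⌈R⌉) ⌈R⌉ ×ˢ Icc (-⌈R⌉) ⌈R⌉ ×ˢ Icc (-⌈R⌉) ⌈R⌉ : Set (ℤ × ℤ × ℤ)).Finite :=
    (finite_Icc _ _).prod ((finite_Icc _ _).prod (finite_Icc _ _))
  have key : ∀ m : ℤ, |(m : ℝ)| ≤ R → m ∈ Icc (-⌈R⌉) ⌈R⌉ := by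
    intro m hm
    have h1 := abs_le.1 hm
    have h2 := Int.le_ceil R
    constructor
    · have : (-⌈R⌉ : ℝ) ≤ m := by linarith
      exact_mod_cast this
    · have : (m : ℝ) ≤ ⌈R⌉ := by linarith
      exact_mod_cast this
  refine Finite.of_finite_image (f := Subtype.val) ?_ Subtype.val_injective.injOn
  refine (hfin.image fun p => mk (p.1 : ℝ) (p.2.1 : ℝ) (p.2.2 : ℝ)).subset ?_
  rintro _ ⟨⟨g, m, n, k, rfl⟩, hg, rfl⟩
  have hgK : mk (m : ℝ) n k ∈ K := by
    by_contra h
    exact hg (hKs h)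
  have hn := hR _ hgK
  have hn' : max |(m : ℝ)| (max |(n : ℝ)| |(k : ℝ)|) ≤ R := hn
  rw [max_le_iff, max_le_iff] at hn'
  exact ⟨(m, n, k), ⟨key m hn'.1, key n hn'.2.1, key k hn'.2.2⟩, rfl⟩

/-- The number
`t̂ = sup {t > 0 | B_t(h₁) ∩ B_t(h₂) = ∅ for all h₁ ≠ h₂ in H}`. -/
def tHat : ℝ≥0∞ :=
  sSup {τ : ℝ≥0∞ | ∃ t : ℝ, 0 < t ∧
    (∀ h₁ ∈ intSubgroup, ∀ h₂ ∈ intSubgroup, h₁ ≠ h₂ →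
      SubRiemannian.ball X t h₁ ∩ SubRiemannian.ball X t h₂ = ∅) ∧
    τ = ENNReal.ofReal t}

end Heis

/-! ### The Heisenberg nil-manifold -/

/-- The nil-manifold `M = {H g | g ∈ G}`, with its quotient topology and the charts given by the
local inverses of the covering `G → M`. -/
abbrev NilManifold : Type := MulAction.orbitRel.Quotient Heis.intSubgroup Heis

namespace NilManifold

/-- The projection `π : G → M`, `g ↦ H g`. -/
def proj (g : Heis) : NilManifold := Quotient.mk _ g

theorem proj_eq_iff {g g' : Heis} : proj g = proj g' ↔ ∃ h ∈ Heis.intSubgroup, h * g' = g :=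
  Quotient.eq''.trans ⟨fun ⟨h, hh⟩ => ⟨h, h.2, hh⟩, fun ⟨h, h1, hh⟩ => ⟨⟨h, h1⟩, hh⟩⟩

theorem isLocalHomeomorph_proj : IsLocalHomeomorph proj :=
  isQuotientCoveringMap_quotientMk_of_properlyDiscontinuousSMul.isCoveringMap.isLocalHomeomorph

theorem chart_symm_eq {e : OpenPartialHomeomorph NilManifold Heis}
    (he : e ∈ atlas Heis NilManifold) : (e.symm : Heis → NilManifold) = proj := by
  obtain ⟨q, rfl⟩ := he
  funext g
  simp only [OpenPartialHomeomorph.trans_symm_eq_symm_trans_symm, OpenPartialHomeomorph.coe_trans,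
    Function.comp_apply, IsLocalHomeomorph.localInverseAt_symm]
  rfl

theorem proj_chart {e : OpenPartialHomeomorph NilManifold Heis}
    (he : e ∈ atlas Heis NilManifold) {q : NilManifold} (hq : q ∈ e.source) : proj (e q) = q := by
  rw [← chart_symm_eq he, e.left_inv hq]

/-- A continuous local lift of `π` is locally a left translation by an element of `H`. -/
theorem eventuallyEq_translation {f : Heis → Heis} {g : Heis} (hf : ContinuousAt f g)
    (h : ∀ᶠ g' in 𝓝 g, proj (f g') = proj g') :
    ∃ h ∈ Heis.intSubgroup, f =ᶠ[𝓝 g] fun g' => h * g' := by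
  obtain ⟨h₀, hh, hg⟩ := proj_eq_iff.1 h.self_of_nhds
  refine ⟨h₀, hh, ?_⟩
  obtain ⟨e, hge, he⟩ := isLocalHomeomorph_proj (f g)
  have hU : e.source ∈ 𝓝 (f g) := e.open_source.mem_nhds hge
  have h1 := hf hU
  have h2 : ContinuousAt (fun g' : Heis => h₀ * g') g :=
    (Heis.contDiff_mul_left h₀).continuous.continuousAt
  have h3 : (fun g' : Heis => h₀ * g') ⁻¹' e.source ∈ 𝓝 g := h2 (by simpa only [hg] using hU)
  filter_upwards [h, h1, h3] with g' h4 h5 h6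
  apply e.injOn h5 h6
  rw [← he]
  exact h4.trans (proj_eq_iff.2 ⟨h₀, hh, rfl⟩).symm

instance : IsManifold 𝓘(ℝ, Heis) ∞ NilManifold := by
  apply isManifold_of_contDiffOn
  intro e e' he he'
  simp only [modelWithCornersSelf_coe, modelWithCornersSelf_coe_symm, Function.comp_id,
    Function.id_comp, preimage_id, range_id, inter_univ]
  intro g hg
  have hs := (e.symm.trans e').open_source.mem_nhds hg
  obtain ⟨h, -, hh⟩ := eventuallyEq_translation ((e.symm.trans e').continuousAt hg)
    (by
      filter_upwards [hs] with g' hg'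
      rw [OpenPartialHomeomorph.trans_source] at hg'
      rw [OpenPartialHomeomorph.coe_trans, Function.comp_apply, proj_chart he' hg'.2,
        chart_symm_eq he])
  exact ((Heis.contDiff_mul_left h).contDiffAt.congr_of_eventuallyEq hh).contDiffWithinAt

theorem contMDiff_proj : ContMDiff 𝓘(ℝ, Heis) 𝓘(ℝ, Heis) ∞ proj := by
  intro g
  have hc : ContinuousAt proj g := isLocalHomeomorph_proj.continuous.continuousAt
  rw [contMDiffAt_iff]
  refine ⟨hc, ?_⟩
  have he := chart_mem_atlas Heis (proj g)
  have hs : (chartAt Heis (proj g)).source ∈ 𝓝 (proj g) := chart_source_mem_nhds _ _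
  obtain ⟨h, -, hh⟩ := eventuallyEq_translation (f := chartAt Heis (proj g) ∘ proj) (g := g)
    (((chartAt Heis (proj g)).continuousAt (mem_chart_source _ _)).comp hc)
    (by
      filter_upwards [hc hs] with g' hg'
      exact proj_chart he hg')
  simpa [chartAt_self_eq] using ((Heis.contDiff_mul_left h).contDiffAt.congr_of_eventuallyEq hh).contDiffWithinAt

/-- The projected frame `X_i' = π_* X_i`, computed at a representative of each coset; by
`mfderiv_proj_X` below, the choice of the representative does not matter. -/
def X : Fin 2 → (q : NilManifold) → TangentSpace 𝓘(ℝ, Heis) q :=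
  fun i q => mfderiv 𝓘(ℝ, Heis) 𝓘(ℝ, Heis) proj (Quotient.out q) (Heis.X i (Quotient.out q))

theorem proj_mul (h : Heis) (hh : h ∈ Heis.intSubgroup) (g : Heis) : proj (h * g) = proj g :=
  proj_eq_iff.2 ⟨h, hh, rfl⟩

theorem hasFDerivAt_mul_left (h g : Heis) :
    ∃ L : Heis →L[ℝ] Heis, HasFDerivAt (fun g' : Heis => h * g') L g ∧
      ∀ i, L (Heis.X i g) = Heis.X i (h * g) := by
  let l : Heis →ₗ[ℝ] Heis :=
    { toFun := fun v => Heis.mk v.a v.b (v.c + h.a * v.b)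
      map_add' := by
        intro v w
        apply Heis.ext
        · rfl
        · rfl
        · change v.c + w.c + h.a * (v.b + w.b) = (v.c + h.a * v.b) + (w.c + h.a * w.b)
          ring
      map_smul' := by
        intro r v
        apply Heis.ext
        · rfl
        · rfl
        · change r * v.c + h.a * (r * v.b) = r * (v.c + h.a * v.b)
          ring }
  refine ⟨l.toContinuousLinearMap, ?_, ?_⟩
  · have key : (fun g' : Heis => h * g') = fun g' => h + l.toContinuousLinearMap g' := by
      funext g'
      apply Heis.ext
      · rfl
      · rfl
      · change h.c + g'.c + h.a * g'.b = h.c + (g'.c + h.a * g'.b)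
        ring
    rw [key]
    exact (l.toContinuousLinearMap.hasFDerivAt).const_add h
  · intro i
    fin_cases i
    · change Heis.mk 1 0 (0 + h.a * 0) = Heis.mk 1 0 0
      simp
    · change Heis.mk 0 1 (g.a + h.a * 1) = Heis.mk 0 1 (h.a + g.a)
      rw [mul_one, add_comm]

/-- `X_i'(π(g)) = π_* X_i(g)` for every `g`. -/
theorem mfderiv_proj_X (i : Fin 2) (g : Heis) :
    mfderiv 𝓘(ℝ, Heis) 𝓘(ℝ, Heis) proj g (Heis.X i g) = X i (proj g) := by
  have key : ∀ g₀ : Heis, proj g₀ = proj g →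
      (mfderiv 𝓘(ℝ, Heis) 𝓘(ℝ, Heis) proj g (Heis.X i g) : Heis) =
        mfderiv 𝓘(ℝ, Heis) 𝓘(ℝ, Heis) proj g₀ (Heis.X i g₀) := by
    intro g₀ hg₀
    obtain ⟨h, hh, rfl⟩ := proj_eq_iff.1 hg₀
    obtain ⟨L, hL, hLX⟩ := hasFDerivAt_mul_left h g
    have h1 : HasMFDerivAt 𝓘(ℝ, Heis) 𝓘(ℝ, Heis) proj (h * g)
        (mfderiv 𝓘(ℝ, Heis) 𝓘(ℝ, Heis) proj (h * g)) :=
      ((contMDiff_proj (h * g)).mdifferentiableAt (by simp)).hasMFDerivAt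
    have h2 := HasMFDerivAt.comp g h1 hL.hasMFDerivAt
    have h3 : proj ∘ (fun g' : Heis => h * g') = proj := funext fun g' => proj_mul h hh g'
    rw [h3] at h2
    rw [h2.mfderiv, ← hLX i]
    rfl
  exact key (Quotient.out (proj g)) (Quotient.out_eq (proj g))

end NilManifold

end

/-! Two facts carry the theorem: distinct points of `H` are far apart, and `π` is a covering that
preserves horizontality and length.

Separation (`Heis.one_le_dist_add_dist`): if horizontal curves of lengths l₁, l₂ join h₁ and h₂ in
`H` to a common point and l₁ + l₂ < 1, then h₁ = h₂. The coordinates a and b vary by at most the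
length, so the integers a(h₁), a(h₂) differ by less than 1 and agree, and likewise for b. On a
horizontal curve c' = a b', so c - a(h)b varies by at most the squared length; as a and b agree, the
integers c(h₁), c(h₂) differ by at most l₁² + l₂² < 1. Hence closed balls of radius below 1/2 about
points of `H` are disjoint, while the midpoint of the segment from Id to (1,0,0) rules out larger
radii: t̂ = 1/2.

Covering: horizontal curves of `M` lift to horizontal curves of the same length. So `π` does not
increase distances, and a curve whose projection is minimizing is itself minimizing; this gives (1).
Conversely, let a minimizer from Id have length l < 1/2. A competitor of its projection, lifted so
as to end at the same point, starts at some k in `H`. If k = Id it has length at least l by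
minimality; otherwise at least 1 - l > l by separation. So minimizers shorter than 1/2 project to
minimizers (`NilManifold.isLengthMinimizer_proj_comp`), which gives (3), and also (2) because
initial arcs of minimizers are minimizers. -/

namespace Heis

/-! ### Horizontal vectors and curves of the Heisenberg group in coordinates -/

theorem hasDerivAt_a {γ : ℝ → Heis} {v : Heis} {r : ℝ} (h : HasDerivAt γ v r) :
    HasDerivAt (fun r => (γ r).a) v.a r :=
  (ContinuousLinearMap.fst ℝ ℝ (ℝ × ℝ)).hasFDerivAt.comp_hasDerivAt (F := ℝ × ℝ × ℝ) r h

theorem hasDerivAt_b {γ : ℝ → Heis} {v : Heis} {r : ℝ} (h : HasDerivAt γ v r) :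
    HasDerivAt (fun r => (γ r).b) v.b r :=
  ((ContinuousLinearMap.fst ℝ ℝ ℝ).comp
    (ContinuousLinearMap.snd ℝ ℝ (ℝ × ℝ))).hasFDerivAt.comp_hasDerivAt (F := ℝ × ℝ × ℝ) r h

theorem hasDerivAt_c {γ : ℝ → Heis} {v : Heis} {r : ℝ} (h : HasDerivAt γ v r) :
    HasDerivAt (fun r => (γ r).c) v.c r :=
  ((ContinuousLinearMap.snd ℝ ℝ ℝ).comp
    (ContinuousLinearMap.snd ℝ ℝ (ℝ × ℝ))).hasFDerivAt.comp_hasDerivAt (F := ℝ × ℝ × ℝ) r h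

theorem lipschitzWith_a : LipschitzWith 1 a := LipschitzWith.prod_fst

theorem lipschitzWith_b : LipschitzWith 1 b := by
  have h := (LipschitzWith.prod_fst (α := ℝ) (β := ℝ)).comp
    (LipschitzWith.prod_snd (α := ℝ) (β := ℝ × ℝ))
  rw [one_mul] at h
  exact h

theorem lipschitzWith_c : LipschitzWith 1 c := by
  have h := (LipschitzWith.prod_snd (α := ℝ) (β := ℝ)).comp
    (LipschitzWith.prod_snd (α := ℝ) (β := ℝ × ℝ))
  rw [one_mul] at h
  exact h

theorem sum_smul_X (u : Fin 2 → ℝ) (q : Heis) :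
    (∑ i, u i • (X i q : Heis)) = mk (u 0) (u 1) (q.a * u 1) := by
  rw [Fin.sum_univ_two]
  apply Heis.ext
  · change u 0 * 1 + u 1 * 0 = u 0
    ring
  · change u 0 * 0 + u 1 * 1 = u 1
    ring
  · change u 0 * 0 + u 1 * q.a = q.a * u 1
    ring

/-- The distribution is the kernel of the contact form dc - a db; the frame coefficients of a
horizontal vector are its a- and b-components. -/
theorem mem_distribution_iff {q : Heis} {v : TangentSpace 𝓘(ℝ, Heis) q} :
    v ∈ SubRiemannian.distribution X q ↔ c v = q.a * b v := by
  rw [SubRiemannian.distribution, Submodule.mem_span_range_iff_exists_fun]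
  constructor
  · rintro ⟨u, rfl⟩
    have h := sum_smul_X u q
    erw [h]
    rfl
  · intro h
    refine ⟨![a v, b v], (sum_smul_X _ q).trans ?_⟩
    exact Heis.ext rfl rfl h.symm

/-- The frame is linearly independent, so the infimum runs over a single number. -/
theorem frameNorm_eq {q : Heis} {v : TangentSpace 𝓘(ℝ, Heis) q}
    (hv : v ∈ SubRiemannian.distribution X q) :
    SubRiemannian.frameNorm X q v = √(a v ^ 2 + b v ^ 2) := by
  rw [mem_distribution_iff] at hv
  have : {r : ℝ | ∃ u : Fin 2 → ℝ, v = ∑ i, u i • X i q ∧ r = √(∑ i, u i ^ 2)} =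
      {√(a v ^ 2 + b v ^ 2)} := by
    ext r
    simp only [mem_ofPred_eq, mem_singleton_iff]
    constructor
    · rintro ⟨u, hu, rfl⟩
      have h := hu.trans (sum_smul_X u q)
      rw [Fin.sum_univ_two, h]
      rfl
    · rintro rfl
      refine ⟨![a v, b v], Eq.symm ((sum_smul_X _ q).trans ?_), ?_⟩
      · exact Heis.ext rfl rfl hv.symm
      · simp
  rw [SubRiemannian.frameNorm, this, csInf_singleton]

theorem abs_a_le_frameNorm {q : Heis} {v : TangentSpace 𝓘(ℝ, Heis) q}
    (hv : v ∈ SubRiemannian.distribution X q) : |a v| ≤ SubRiemannian.frameNorm X q v := by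
  rw [frameNorm_eq hv]
  exact Real.abs_le_sqrt (by nlinarith [sq_nonneg (b v)])

theorem abs_b_le_frameNorm {q : Heis} {v : TangentSpace 𝓘(ℝ, Heis) q}
    (hv : v ∈ SubRiemannian.distribution X q) : |b v| ≤ SubRiemannian.frameNorm X q v := by
  rw [frameNorm_eq hv]
  exact Real.abs_le_sqrt (by nlinarith [sq_nonneg (a v)])

theorem velocity_eq_deriv (γ : ℝ → Heis) (r : ℝ) :
    SubRiemannian.velocity (E := Heis) γ r = deriv γ r :=
  congrArg (fun L : ℝ →L[ℝ] Heis => L 1) mfderiv_eq_fderiv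

theorem isLipschitzCurve_iff {γ : ℝ → Heis} {s t : ℝ} :
    SubRiemannian.IsLipschitzCurve Heis γ s t ↔ ∃ K, LipschitzOnWith K γ (Icc s t) := by
  constructor
  · rintro ⟨-, h⟩
    refine LocallyLipschitzOn.exists_lipschitzOnWith_of_compact isCompact_Icc ?_
    intro r hr
    obtain ⟨K, U, hU, hK⟩ := h r hr
    -- The preferred chart of a normed space is the identity, so the two local conditions agree by
    -- definition.
    exact ⟨K, U, hU, hK⟩
  · rintro ⟨K, hK⟩
    exact ⟨hK.continuousOn, fun r _ => ⟨K, _, self_mem_nhdsWithin, hK⟩⟩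

/-- Horizontality of a curve in the Heisenberg group, in terms of its derivative. -/
theorem isHorizontal_iff {γ : ℝ → Heis} {s t : ℝ} :
    SubRiemannian.IsHorizontal X γ s t ↔ (∃ K, LipschitzOnWith K γ (Icc s t)) ∧
      ∀ᵐ r ∂(volume.restrict (Icc s t)), DifferentiableAt ℝ γ r ∧
        deriv γ r ∈ SubRiemannian.distribution X (γ r) := by
  constructor
  · rintro ⟨h1, h2⟩
    refine ⟨isLipschitzCurve_iff.1 h1, h2.mono fun r hr => ?_⟩
    rw [← velocity_eq_deriv]
    exact ⟨mdifferentiableAt_iff_differentiableAt.1 hr.1, hr.2⟩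
  · rintro ⟨h1, h2⟩
    refine ⟨isLipschitzCurve_iff.2 h1, h2.mono fun r hr => ?_⟩
    rw [velocity_eq_deriv]
    exact ⟨mdifferentiableAt_iff_differentiableAt.2 hr.1, hr.2⟩

theorem length_eq (γ : ℝ → Heis) (s t : ℝ) : SubRiemannian.length X γ s t =
    ∫⁻ r in Icc s t, ENNReal.ofReal (SubRiemannian.frameNorm X (γ r) (deriv γ r)) := by
  simp only [SubRiemannian.length, velocity_eq_deriv]
  rfl

end Heis

/-! ### Additivity of length and restriction to subintervals -/

namespace SubRiemannian

variable {E : Type*} [NormedAddCommGroup E] [NormedSpace ℝ E]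
  {M : Type*} [TopologicalSpace M] [ChartedSpace E M] {k : ℕ}
  {X : Fin k → (q : M) → TangentSpace 𝓘(ℝ, E) q} {γ : ℝ → M}

theorem length_mono {s t s' t' : ℝ} (hs : s' ≤ s) (ht : t ≤ t') :
    length X γ s t ≤ length X γ s' t' :=
  lintegral_mono_set (Icc_subset_Icc hs ht)

theorem length_add {r s t : ℝ} (hrs : r ≤ s) (hst : s ≤ t) :
    length X γ r s + length X γ s t = length X γ r t := by
  unfold length
  rw [← setLIntegral_congr (μ := volume) (Ioc_ae_eq_Icc (a := s) (b := t)),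
    ← lintegral_union measurableSet_Ioc, Icc_union_Ioc_eq_Icc hrs hst]
  rw [Set.disjoint_left]
  exact fun x hx hx' => absurd hx.2 (not_le.2 hx'.1)

theorem IsLipschitzCurve.mono {s t s' t' : ℝ} (h : IsLipschitzCurve E γ s t) (hs : s ≤ s')
    (ht : t' ≤ t) : IsLipschitzCurve E γ s' t' := by
  have hss := Icc_subset_Icc hs ht
  refine ⟨h.1.mono hss, fun r hr => ?_⟩
  obtain ⟨K, U, hU, hK⟩ := h.2 r (hss hr)
  exact ⟨K, U, nhdsWithin_mono r hss hU, hK⟩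

theorem IsHorizontal.mono {s t s' t' : ℝ} (h : IsHorizontal X γ s t) (hs : s ≤ s')
    (ht : t' ≤ t) : IsHorizontal X γ s' t' :=
  ⟨h.1.mono hs ht, ae_restrict_of_ae_restrict_of_subset (Icc_subset_Icc hs ht) h.2⟩

theorem dist_le_length {T : ℝ} (hT : 0 ≤ T) (h : IsHorizontal X γ 0 T) :
    dist X (γ 0) (γ T) ≤ length X γ 0 T :=
  sInf_le ⟨γ, T, hT, h, rfl, rfl, rfl⟩

end SubRiemannian

/-! ### Displacement bounds and the separation of integer points -/

namespace Heis

open SubRiemannian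

/-- A Lipschitz function whose derivative is at most `C` times the speed of `γ` varies by at most
`C` times the length of `γ`. -/
theorem abs_sub_le_of_abs_deriv_le {γ : ℝ → Heis} {s t l C : ℝ} {K : ℝ≥0} {F : ℝ → ℝ} (hst : s ≤ t)
    (hC : 0 ≤ C) (hl : 0 ≤ l) (hF : LipschitzOnWith K F (Icc s t))
    (hd : ∀ᵐ r ∂(volume.restrict (Icc s t)), |deriv F r| ≤ C * frameNorm X (γ r) (deriv γ r))
    (hlen : length X γ s t ≤ ENNReal.ofReal l) : |F t - F s| ≤ C * l := by
  -- Lipschitz functions are absolutely continuous, so the increment of `F` is the integral of its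
  -- almost everywhere derivative.
  have hac : AbsolutelyContinuousOnInterval F s t :=
    LipschitzOnWith.absolutelyContinuousOnInterval (by rwa [uIcc_of_le hst])
  have h1 : ‖F t - F s‖ₑ ≤ ENNReal.ofReal C * ENNReal.ofReal l := by
    rw [← hac.integral_deriv_eq_sub, intervalIntegral.integral_of_le hst,
      ← integral_Icc_eq_integral_Ioc]
    refine (enorm_integral_le_lintegral_enorm _).trans ?_
    refine le_trans ?_ (mul_le_mul_right hlen _)
    rw [length_eq, ← lintegral_const_mul' _ _ ENNReal.ofReal_ne_top]
    refine lintegral_mono_ae (hd.mono fun r hr => ?_)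
    rw [← ENNReal.ofReal_mul hC, Real.enorm_eq_ofReal_abs]
    exact ENNReal.ofReal_le_ofReal hr
  rw [Real.enorm_eq_ofReal_abs, ← ENNReal.ofReal_mul hC] at h1
  exact (ENNReal.ofReal_le_ofReal_iff (by positivity)).1 h1

theorem abs_sub_a_le {γ : ℝ → Heis} {s t l : ℝ} (hst : s ≤ t) (hl : 0 ≤ l)
    (h : IsHorizontal X γ s t) (hlen : length X γ s t ≤ ENNReal.ofReal l) :
    |(γ t).a - (γ s).a| ≤ l := by
  obtain ⟨⟨K, hK⟩, hd⟩ := isHorizontal_iff.1 h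
  have := abs_sub_le_of_abs_deriv_le (F := fun r => (γ r).a) hst zero_le_one hl
    (lipschitzWith_a.comp_lipschitzOnWith hK) (hd.mono fun r hr => ?_) hlen
  · simpa using this
  · rw [(hasDerivAt_a hr.1.hasDerivAt).deriv, one_mul]
    exact abs_a_le_frameNorm hr.2

theorem abs_sub_b_le {γ : ℝ → Heis} {s t l : ℝ} (hst : s ≤ t) (hl : 0 ≤ l)
    (h : IsHorizontal X γ s t) (hlen : length X γ s t ≤ ENNReal.ofReal l) :
    |(γ t).b - (γ s).b| ≤ l := by
  obtain ⟨⟨K, hK⟩, hd⟩ := isHorizontal_iff.1 h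
  have := abs_sub_le_of_abs_deriv_le (F := fun r => (γ r).b) hst zero_le_one hl
    (lipschitzWith_b.comp_lipschitzOnWith hK) (hd.mono fun r hr => ?_) hlen
  · simpa using this
  · rw [(hasDerivAt_b hr.1.hasDerivAt).deriv, one_mul]
    exact abs_b_le_frameNorm hr.2

/-- The crude isoperimetric inequality: the vertical displacement of a horizontal curve, measured
from its initial point, is at most the square of its length. -/
theorem abs_sub_c_le {γ : ℝ → Heis} {s t l : ℝ} (hst : s ≤ t) (hl : 0 ≤ l)
    (h : IsHorizontal X γ s t) (hlen : length X γ s t ≤ ENNReal.ofReal l) :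
    |(γ t).c - (γ s).c - (γ s).a * ((γ t).b - (γ s).b)| ≤ l * l := by
  obtain ⟨⟨K, hK⟩, hd⟩ := isHorizontal_iff.1 h
  -- By horizontality the derivative of c - a(s)b is (a(r) - a(s)) b'(r): the first factor is at
  -- most `l`, the second at most the speed.
  obtain ⟨K', hK'⟩ : ∃ K', LipschitzOnWith K' (fun r => (γ r).c - (γ s).a * (γ r).b) (Icc s t) :=
    ⟨_, (lipschitzWith_c.comp_lipschitzOnWith hK).sub
      ((lipschitzWith_smul (γ s).a).comp_lipschitzOnWith
        (lipschitzWith_b.comp_lipschitzOnWith hK))⟩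
  have := abs_sub_le_of_abs_deriv_le hst hl hl hK' ?_ hlen
  · convert this using 2
    ring
  filter_upwards [hd, ae_restrict_mem measurableSet_Icc] with r hr hrI
  have h1 := hr.1.hasDerivAt
  have h2 : deriv (fun r => (γ r).c - (γ s).a * (γ r).b) r =
      c (deriv γ r) - (γ s).a * b (deriv γ r) :=
    ((hasDerivAt_c h1).sub ((hasDerivAt_b h1).const_mul (γ s).a)).deriv
  rw [h2, mem_distribution_iff.1 hr.2, ← sub_mul, abs_mul]
  exact mul_le_mul (abs_sub_a_le hrI.1 hl (h.mono le_rfl hrI.2)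
    ((length_mono le_rfl hrI.2).trans hlen)) (abs_b_le_frameNorm hr.2) (abs_nonneg _) hl

/-- A point is at total distance at least `1` from any two distinct integer points. -/
theorem one_le_dist_add_dist {h₁ h₂ q : Heis} (hh₁ : h₁ ∈ intSubgroup) (hh₂ : h₂ ∈ intSubgroup)
    (hne : h₁ ≠ h₂) : 1 ≤ SubRiemannian.dist X h₁ q + SubRiemannian.dist X h₂ q := by
  rw [SubRiemannian.dist, ENNReal.sInf_add]
  refine le_iInf₂ fun _ h => ?_
  obtain ⟨γ₁, T₁, hT₁, hγ₁, hs₁, ht₁, rfl⟩ := h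
  rw [SubRiemannian.dist, add_comm, ENNReal.sInf_add]
  refine le_iInf₂ fun _ h => ?_
  obtain ⟨γ₂, T₂, hT₂, hγ₂, hs₂, ht₂, rfl⟩ := h
  rw [add_comm]
  by_contra! hlt
  apply hne
  have f₁ : length X γ₁ 0 T₁ ≠ ⊤ := ((le_self_add.trans_lt hlt).trans ENNReal.one_lt_top).ne
  have f₂ : length X γ₂ 0 T₂ ≠ ⊤ := ((le_add_self.trans_lt hlt).trans ENNReal.one_lt_top).ne
  have e₁ := (ENNReal.ofReal_toReal f₁).ge
  have e₂ := (ENNReal.ofReal_toReal f₂).ge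
  have hlt' : (length X γ₁ 0 T₁).toReal + (length X γ₂ 0 T₂).toReal < 1 := by
    rw [← ENNReal.toReal_add f₁ f₂, ← ENNReal.toReal_one]
    exact (ENNReal.toReal_lt_toReal (ENNReal.add_ne_top.2 ⟨f₁, f₂⟩) ENNReal.one_ne_top).2 hlt
  have n₁ : 0 ≤ (length X γ₁ 0 T₁).toReal := ENNReal.toReal_nonneg
  have n₂ : 0 ≤ (length X γ₂ 0 T₂).toReal := ENNReal.toReal_nonneg
  generalize (length X γ₁ 0 T₁).toReal = l₁ at *
  generalize (length X γ₂ 0 T₂).toReal = l₂ at *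
  have a₁ := abs_le.1 (abs_sub_a_le hT₁ n₁ hγ₁ e₁)
  have a₂ := abs_le.1 (abs_sub_a_le hT₂ n₂ hγ₂ e₂)
  have b₁ := abs_le.1 (abs_sub_b_le hT₁ n₁ hγ₁ e₁)
  have b₂ := abs_le.1 (abs_sub_b_le hT₂ n₂ hγ₂ e₂)
  have c₁ := abs_le.1 (abs_sub_c_le hT₁ n₁ hγ₁ e₁)
  have c₂ := abs_le.1 (abs_sub_c_le hT₂ n₂ hγ₂ e₂)
  rw [hs₁, ht₁] at a₁ b₁ c₁
  rw [hs₂, ht₂] at a₂ b₂ c₂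
  obtain ⟨m₁, k₁, j₁, rfl⟩ := hh₁
  obtain ⟨m₂, k₂, j₂, rfl⟩ := hh₂
  have int_eq : ∀ i j : ℤ, |(i : ℝ) - j| < 1 → i = j := fun i j h => by
    have : |i - j| < 1 := by exact_mod_cast h
    have := Int.abs_lt_one_iff.1 this
    omega
  simp only [a_mk, b_mk, c_mk] at *
  -- Both curves end at `q`, so the bounds on a and b add up to `l₁ + l₂ < 1`.
  obtain rfl := int_eq m₁ m₂ (abs_lt.2 ⟨by linarith, by linarith⟩)
  obtain rfl := int_eq k₁ k₂ (abs_lt.2 ⟨by linarith, by linarith⟩)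
  -- Here l₁² + l₂² ≤ (l₁ + l₂)² < 1. Once the integers in the a- and b-coordinates agree, the
  -- correction terms in `c₁` and `c₂` coincide and cancel.
  have hsq : l₁ * l₁ + l₂ * l₂ < 1 := by nlinarith
  obtain rfl := int_eq j₁ j₂ (abs_lt.2 ⟨by linarith, by linarith⟩)
  rfl

end Heis

/-! ### Invariance under changing a curve outside the interval -/

namespace SubRiemannian

section Congr

variable {E : Type*} [NormedAddCommGroup E] [NormedSpace ℝ E]
  {M : Type*} [TopologicalSpace M] [ChartedSpace E M] {k : ℕ}
  {X : Fin k → (q : M) → TangentSpace 𝓘(ℝ, E) q} {γ γ' : ℝ → M}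

theorem ae_eventuallyEq_of_eqOn {α : Type*} {γ γ' : ℝ → α} {s t : ℝ}
    (h : EqOn γ γ' (Icc s t)) : ∀ᵐ r ∂(volume.restrict (Icc s t)), γ =ᶠ[𝓝 r] γ' := by
  -- The endpoints are null, and at an interior point equality on the interval is equality near the
  -- point, which is what derivatives need.
  rw [← restrict_Ioo_eq_restrict_Icc]
  filter_upwards [ae_restrict_mem measurableSet_Ioo] with r hr
  filter_upwards [Icc_mem_nhds hr.1 hr.2] with r' hr' using h hr'

/-- Tangent spaces at equal points are distinct types until the equality is substituted, hence the
comparison of vectors in the model space `E`. -/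
theorem frameNorm_congr {q q' : M} {v : TangentSpace 𝓘(ℝ, E) q} {v' : TangentSpace 𝓘(ℝ, E) q'}
    (hq : q = q') (hv : (v : E) = v') : frameNorm X q v = frameNorm X q' v' := by
  subst hq
  exact congrArg (frameNorm X q) hv

theorem mem_distribution_congr {q q' : M} {v : TangentSpace 𝓘(ℝ, E) q}
    {v' : TangentSpace 𝓘(ℝ, E) q'} (hq : q = q') (hv : (v : E) = v') :
    v ∈ distribution X q ↔ v' ∈ distribution X q' := by
  subst hq
  exact iff_of_eq (congrArg (· ∈ distribution X q) hv)

theorem velocity_congr {r : ℝ} (h : γ =ᶠ[𝓝 r] γ') :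
    (velocity (E := E) γ r : E) = velocity (E := E) γ' r :=
  congrArg (fun L : ℝ →L[ℝ] E => L 1) (h.mfderiv_eq (I := 𝓘(ℝ, ℝ)) (I' := 𝓘(ℝ, E)))

theorem length_congr {s t : ℝ} (h : EqOn γ γ' (Icc s t)) : length X γ s t = length X γ' s t :=
  lintegral_congr_ae ((ae_eventuallyEq_of_eqOn h).mono fun _ hr =>
    congrArg ENNReal.ofReal (frameNorm_congr hr.self_of_nhds (velocity_congr hr)))

theorem IsLipschitzCurve.congr {s t : ℝ} (hγ : IsLipschitzCurve E γ s t)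
    (h : EqOn γ' γ (Icc s t)) : IsLipschitzCurve E γ' s t := by
  refine ⟨hγ.1.congr h, fun r hr => ?_⟩
  obtain ⟨K, U, hU, hK⟩ := hγ.2 r hr
  refine ⟨K, U ∩ Icc s t, Filter.inter_mem hU self_mem_nhdsWithin, ?_⟩
  rw [h hr]
  intro x hx y hy
  simp only [h hx.2, h hy.2]
  exact hK hx.1 hy.1

theorem IsHorizontal.congr {s t : ℝ} (hγ : IsHorizontal X γ s t) (h : EqOn γ' γ (Icc s t)) :
    IsHorizontal X γ' s t := by
  refine ⟨hγ.1.congr h, ?_⟩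
  filter_upwards [hγ.2, ae_eventuallyEq_of_eqOn h] with r hr he
  exact ⟨hr.1.congr_of_eventuallyEq he,
    (mem_distribution_congr he.self_of_nhds (velocity_congr he)).2 hr.2⟩

theorem length_eq_of_isArcLength {J : Set ℝ} (hJ : J.OrdConnected) {s t : ℝ} (hs : s ∈ J)
    (ht : t ∈ J) (h : IsArcLength X γ J) : length X γ s t = ENNReal.ofReal (t - s) := by
  have h1 := ae_restrict_of_ae_restrict_of_subset (hJ.out hs ht) h
  rw [length, lintegral_congr_ae (h1.mono fun r hr => congrArg ENNReal.ofReal hr)]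
  simp

end Congr

end SubRiemannian

/-! ### Concatenation of curves and initial arcs of minimizers -/

theorem LipschitzOnWith.union_Icc {α : Type*} [PseudoMetricSpace α] {f : ℝ → α}
    {r s t : ℝ} {K K' : ℝ≥0} (h : LipschitzOnWith K f (Icc r s))
    (h' : LipschitzOnWith K' f (Icc s t)) (hrs : r ≤ s) (hst : s ≤ t) :
    LipschitzOnWith (max K K') f (Icc r t) := by
  have key : ∀ x ∈ Icc r t, ∀ y ∈ Icc r t, x ≤ y →
      Dist.dist (f x) (f y) ≤ (max K K' : ℝ≥0) * Dist.dist x y := by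
    intro x hx y hy hxy
    have h₁ := (h.weaken (le_max_left K K')).dist_le_mul
    have h₂ := (h'.weaken (le_max_right K K')).dist_le_mul
    rcases le_total y s with hys | hys
    · exact h₁ x ⟨hx.1, hxy.trans hys⟩ y ⟨hy.1, hys⟩
    rcases le_total x s with hxs | hxs
    · refine (dist_triangle _ (f s) _).trans ((add_le_add (h₁ x ⟨hx.1, hxs⟩ s ⟨hrs, le_rfl⟩)
        (h₂ s ⟨le_rfl, hst⟩ y ⟨hys, hy.2⟩)).trans ?_)
      rw [← mul_add, Real.dist_eq, Real.dist_eq, Real.dist_eq, abs_of_nonpos (by linarith),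
        abs_of_nonpos (by linarith), abs_of_nonpos (by linarith)]
      exact (congrArg _ (by ring)).le
    · exact h₂ x ⟨hxs, hx.2⟩ y ⟨hys, hy.2⟩
  refine LipschitzOnWith.of_dist_le_mul fun x hx y hy => ?_
  rcases le_total x y with hxy | hxy
  · exact key x hx y hy hxy
  · rw [dist_comm (f x), dist_comm x]
    exact key y hy x hx hxy

namespace Heis

open SubRiemannian

theorem isHorizontal_union {γ : ℝ → Heis} {r s t : ℝ} (hrs : r ≤ s) (hst : s ≤ t)
    (h : IsHorizontal X γ r s) (h' : IsHorizontal X γ s t) : IsHorizontal X γ r t := by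
  rw [isHorizontal_iff] at *
  obtain ⟨⟨K, hK⟩, hd⟩ := h
  obtain ⟨⟨K', hK'⟩, hd'⟩ := h'
  refine ⟨⟨_, hK.union_Icc hK' hrs hst⟩, ?_⟩
  rw [← Icc_union_Icc_eq_Icc hrs hst, ae_restrict_union_iff]
  exact ⟨hd, hd'⟩

theorem isHorizontal_comp_add {γ : ℝ → Heis} {s t : ℝ} (h : IsHorizontal X γ s t) (d : ℝ) :
    IsHorizontal X (fun r => γ (r + d)) (s - d) (t - d) := by
  rw [isHorizontal_iff] at *
  obtain ⟨⟨K, hK⟩, hd⟩ := h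
  refine ⟨⟨K * 1, hK.comp (isometry_add_right d).lipschitz.lipschitzOnWith ?_⟩, ?_⟩
  · exact fun r hr => ⟨by linarith [hr.1], by linarith [hr.2]⟩
  · rw [← preimage_add_const_Icc]
    filter_upwards [((measurePreserving_add_right volume d).restrict_preimage
      measurableSet_Icc).quasiMeasurePreserving.ae hd] with r hr
    rw [deriv_comp_add_const]
    exact ⟨differentiableAt_comp_add_const.2 hr.1, hr.2⟩

theorem length_comp_add (γ : ℝ → Heis) (s t d : ℝ) :
    length X (fun r => γ (r + d)) (s - d) (t - d) = length X γ s t := by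
  rw [length_eq, length_eq, ← preimage_add_const_Icc]
  refine Eq.trans (lintegral_congr fun r => ?_)
    ((measurePreserving_add_right volume d).setLIntegral_comp_preimage_emb
      (measurableEmbedding_addRight d)
      (fun r => ENNReal.ofReal (frameNorm X (γ r) (deriv γ r))) (Icc s t))
  exact congrArg ENNReal.ofReal (frameNorm_congr rfl (deriv_comp_add_const γ d r))

/-- The distance is at most the length of a concatenation. -/
theorem dist_le_length_add_length {γ₁ γ₂ : ℝ → Heis} {T s t : ℝ} (hT : 0 ≤ T) (hst : s ≤ t)
    (h₁ : IsHorizontal X γ₁ 0 T) (h₂ : IsHorizontal X γ₂ s t) (h : γ₁ T = γ₂ s) :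
    SubRiemannian.dist X (γ₁ 0) (γ₂ t) ≤ length X γ₁ 0 T + length X γ₂ s t := by
  -- Time is translated so that the second curve starts at `T`, where the first one ends.
  have h₂' := isHorizontal_comp_add h₂ (s - T)
  rw [← length_comp_add γ₂ s t (s - T)]
  have e₁ : s - (s - T) = T := by ring
  have hTt : T ≤ t - (s - T) := by linarith
  rw [e₁] at h₂' ⊢
  let γ : ℝ → Heis := fun r => if r ≤ T then γ₁ r else γ₂ (r + (s - T))
  have g₁ : EqOn γ γ₁ (Icc 0 T) := fun r hr => if_pos hr.2
  have g₂ : EqOn γ (fun r => γ₂ (r + (s - T))) (Icc T (t - (s - T))) := fun r hr => by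
    rcases hr.1.eq_or_lt with rfl | hlt
    · simp [γ, h]
    · exact if_neg (not_le.2 hlt)
  have hγ := isHorizontal_union hT hTt (h₁.congr g₁) (h₂'.congr g₂)
  have hle := dist_le_length (hT.trans hTt) hγ
  rw [← length_add hT hTt, length_congr g₁, length_congr g₂, g₁ ⟨le_rfl, hT⟩,
    g₂ ⟨hTt, le_rfl⟩] at hle
  simpa using hle

/-- An initial arc of a minimizer of finite length is a minimizer. -/
theorem isLengthMinimizer_of_le {γ : ℝ → Heis} {s t : ℝ} (hs : 0 ≤ s) (hst : s ≤ t)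
    (h : IsLengthMinimizer X γ 0 t) (hfin : length X γ 0 t ≠ ⊤) : IsLengthMinimizer X γ 0 s := by
  have hγ := h.1.mono le_rfl hst
  refine ⟨hγ, le_antisymm (le_sInf ?_) (dist_le_length hs hγ)⟩
  rintro _ ⟨γ₁, T, hT, h₁, h0, h1, rfl⟩
  -- A competitor of the initial arc, followed by the remaining arc, competes with the whole
  -- minimizer; the tail has finite length and cancels.
  have hle := dist_le_length_add_length hT hst h₁ (h.1.mono hs le_rfl) h1
  have hadd := length_add (X := X) (γ := γ) hs hst
  rw [h0, ← h.2, ← hadd] at hle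
  exact ENNReal.le_of_add_le_add_right (fun h' => hfin (by rw [← hadd, h', add_top])) hle

/-! ### Horizontal segments and the value of t̂ -/

theorem isHorizontal_mk_line (x σ s t : ℝ) :
    IsHorizontal X (fun r => mk (x + σ * r) 0 0) s t ∧
      length X (fun r => mk (x + σ * r) 0 0) s t = ENNReal.ofReal |σ| * ENNReal.ofReal (t - s) := by
  have hd : ∀ r : ℝ, HasDerivAt (fun r => mk (x + σ * r) 0 0) (mk σ 0 0) r := fun r => by
    have h1 : HasDerivAt (fun r => x + σ * r) σ r := by
      simpa using ((hasDerivAt_id r).const_mul σ).const_add x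
    exact h1.prodMk ((hasDerivAt_const r (0 : ℝ)).prodMk (hasDerivAt_const r (0 : ℝ)))
  have hm : ∀ r : ℝ, deriv (fun r => mk (x + σ * r) 0 0) r ∈
      distribution X (mk (x + σ * r) 0 0) := fun r => by
    refine mem_distribution_iff.2 ?_
    rw [(hd r).deriv]
    simp
  constructor
  · rw [isHorizontal_iff]
    refine ⟨?_, Filter.Eventually.of_forall fun r => ⟨(hd r).differentiableAt, hm r⟩⟩
    refine LocallyLipschitzOn.exists_lipschitzOnWith_of_compact isCompact_Icc
      (LocallyLipschitz.locallyLipschitzOn ?_)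
    have : ContDiff ℝ ∞ fun r : ℝ => mk (x + σ * r) 0 0 :=
      contDiff_mk (by fun_prop) (by fun_prop) (by fun_prop)
    exact (this.of_le (by simp)).locallyLipschitz
  · rw [length_eq]
    have hn : ∀ r : ℝ, frameNorm X (mk (x + σ * r) 0 0)
        (deriv (fun r => mk (x + σ * r) 0 0) r) = |σ| := fun r => by
      refine (frameNorm_eq (hm r)).trans ?_
      rw [(hd r).deriv]
      simp [Real.sqrt_sq_eq_abs]
    rw [lintegral_congr fun r => congrArg ENNReal.ofReal (hn r)]
    simp

theorem tHat_eq : tHat = 1 / 2 := by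
  have half : (1 / 2 : ℝ≥0∞) = ENNReal.ofReal (1 / 2) := by
    rw [ENNReal.ofReal_div_of_pos (by norm_num)]
    simp
  apply le_antisymm
  · apply sSup_le
    rintro _ ⟨t, ht, h, rfl⟩
    rw [half]
    apply ENNReal.ofReal_le_ofReal
    by_contra! hlt
    have h01 : mk 0 0 0 ≠ mk 1 0 0 := fun h => by simpa using congrArg a h
    have hempty := h (mk 0 0 0) ⟨0, 0, 0, by simp⟩ (mk 1 0 0) ⟨1, 0, 0, by simp⟩ h01
    have hdist : ∀ x σ : ℝ, |σ| = 1 →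
        SubRiemannian.dist X (mk x 0 0) (mk (x + σ * (1 / 2)) 0 0) ≤ ENNReal.ofReal t :=
      fun x σ hσ => by
        obtain ⟨h1, h2⟩ := isHorizontal_mk_line x σ 0 (1 / 2)
        have h3 := dist_le_length (by norm_num) h1
        rw [h2, hσ] at h3
        simp only [mul_zero, add_zero, ENNReal.ofReal_one, one_mul, sub_zero] at h3
        exact h3.trans (ENNReal.ofReal_le_ofReal hlt.le)
    -- The midpoint of the horizontal segment from Id to (1,0,0) lies in both balls.
    have hmem : mk (1 / 2) 0 0 ∈ ball X t (mk 0 0 0) ∩ ball X t (mk 1 0 0) := by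
      constructor
      · have h2 := hdist 0 1 (by simp)
        norm_num at h2
        exact h2
      · have h2 := hdist 1 (-1) (by simp)
        norm_num at h2
        exact h2
    rw [hempty] at hmem
    exact hmem
  · refine le_of_forall_lt fun τ hτ => ?_
    -- The radius must be positive, which `τ` need not be, and strictly below 1/2, since the closed
    -- balls of radius 1/2 about Id and (1,0,0) already meet.
    obtain ⟨τ', h1, h2⟩ := exists_between hτ
    refine h1.trans_le (le_sSup ⟨τ'.toReal, ENNReal.toReal_pos (pos_of_gt h1).ne' h2.ne_top, ?_,
      (ENNReal.ofReal_toReal h2.ne_top).symm⟩)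
    intro h₁ hh₁ h₂ hh₂ hne
    by_contra hn
    obtain ⟨q, hq₁, hq₂⟩ := nonempty_iff_ne_empty.2 hn
    have hq₁' : SubRiemannian.dist X h₁ q ≤ ENNReal.ofReal τ'.toReal := hq₁
    have hq₂' : SubRiemannian.dist X h₂ q ≤ ENNReal.ofReal τ'.toReal := hq₂
    rw [ENNReal.ofReal_toReal h2.ne_top] at hq₁' hq₂'
    have := (one_le_dist_add_dist hh₁ hh₂ hne).trans (add_le_add hq₁' hq₂')
    refine absurd this (not_le.2 ((ENNReal.add_lt_add h2 h2).trans_le ?_))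
    rw [ENNReal.add_halves]

end Heis

/-! ### The projection preserves horizontality and length -/

namespace NilManifold

open SubRiemannian

theorem exists_lipschitzWith_mul_left (h : Heis) :
    ∃ K, LipschitzWith K fun g : Heis => h * g := by
  let l : Heis →ₗ[ℝ] Heis :=
    { toFun := fun v => Heis.mk v.a v.b (v.c + h.a * v.b)
      map_add' := fun v w => Heis.ext rfl rfl (show v.c + w.c + h.a * (v.b + w.b) =
        (v.c + h.a * v.b) + (w.c + h.a * w.b) by ring)
      map_smul' := fun r v => Heis.ext rfl rfl (show r * v.c + h.a * (r * v.b) =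
        r * (v.c + h.a * v.b) by ring) }
  have key : (fun g : Heis => h * g) = fun g => h + l.toContinuousLinearMap g := by
    funext g
    exact Heis.ext rfl rfl (show h.c + g.c + h.a * g.b = h.c + (g.c + h.a * g.b) by ring)
  rw [key]
  exact ⟨_, (LipschitzWith.const h).add l.toContinuousLinearMap.lipschitz⟩

theorem continuous_proj : Continuous proj := isLocalHomeomorph_proj.continuous

/-- In the charts, the projection is a left translation near every point. -/
theorem exists_chart_proj_eventuallyEq (g : Heis) :
    ∃ h : Heis, (fun g' => chartAt Heis (proj g) (proj g')) =ᶠ[𝓝 g] fun g' => h * g' := by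
  have hc : ContinuousAt proj g := continuous_proj.continuousAt
  obtain ⟨h, -, hh⟩ := eventuallyEq_translation (f := chartAt Heis (proj g) ∘ proj) (g := g)
    (((chartAt Heis (proj g)).continuousAt (mem_chart_source _ _)).comp hc)
    (by
      filter_upwards [hc (chart_source_mem_nhds Heis _)] with g' hg'
      exact proj_chart (chart_mem_atlas Heis _) hg')
  exact ⟨h, hh⟩

/-- A chart composed with `proj` is locally a left translation, and undoing that translation gives a
differentiable local inverse of `proj`. -/
theorem exists_local_section (g : Heis) : ∃ σ : NilManifold → Heis,
    MDifferentiableAt 𝓘(ℝ, Heis) 𝓘(ℝ, Heis) σ (proj g) ∧ ∀ᶠ g' in 𝓝 g, σ (proj g') = g' := by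
  obtain ⟨h, hh⟩ := exists_chart_proj_eventuallyEq g
  refine ⟨fun q => h⁻¹ * extChartAt 𝓘(ℝ, Heis) (proj g) q, ?_, ?_⟩
  · exact MDifferentiableAt.comp (proj g) (I' := 𝓘(ℝ, Heis))
      (((Heis.contDiff_mul_left h⁻¹).contDiffAt.differentiableAt (by simp)).mdifferentiableAt)
      (mdifferentiableAt_extChartAt (mem_chart_source _ _))
  · filter_upwards [hh] with g' hg'
    have hg'' : extChartAt 𝓘(ℝ, Heis) (proj g) (proj g') = h * g' := hg'
    rw [hg'', inv_mul_cancel_left]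

theorem mdifferentiableAt_proj (g : Heis) :
    MDifferentiableAt 𝓘(ℝ, Heis) 𝓘(ℝ, Heis) proj g :=
  (contMDiff_proj g).mdifferentiableAt (by simp)

theorem mfderiv_proj_injective (g : Heis) :
    Function.Injective (mfderiv 𝓘(ℝ, Heis) 𝓘(ℝ, Heis) proj g) := by
  obtain ⟨σ, hσ, h⟩ := exists_local_section g
  have h1 := HasMFDerivAt.comp g hσ.hasMFDerivAt (mdifferentiableAt_proj g).hasMFDerivAt
  have h2 : HasMFDerivAt 𝓘(ℝ, Heis) 𝓘(ℝ, Heis) (σ ∘ proj) g _ :=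
    (hasMFDerivAt_id g).congr_of_eventuallyEq h
  have h3 := hasMFDerivAt_unique h1 h2
  intro v w hvw
  have h4 : ∀ u, mfderiv 𝓘(ℝ, Heis) 𝓘(ℝ, Heis) σ (proj g)
      (mfderiv 𝓘(ℝ, Heis) 𝓘(ℝ, Heis) proj g u) = u := fun u =>
    congrArg (fun L : Heis →L[ℝ] Heis => L u) h3
  rw [← h4 v, hvw, h4 w]

/-- The differential of `proj` is injective and carries one frame to the other, so coefficients in
the frames correspond; both the distribution and the norm are defined through these coefficients. -/
theorem mfderiv_proj_eq_sum_iff {g : Heis} {v : TangentSpace 𝓘(ℝ, Heis) g} {u : Fin 2 → ℝ} :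
    mfderiv 𝓘(ℝ, Heis) 𝓘(ℝ, Heis) proj g v = ∑ i, u i • X i (proj g) ↔
      v = ∑ i, u i • Heis.X i g := by
  rw [← (mfderiv_proj_injective g).eq_iff, map_sum]
  simp only [map_smul, mfderiv_proj_X]

theorem mfderiv_proj_mem_distribution_iff {g : Heis} {v : TangentSpace 𝓘(ℝ, Heis) g} :
    mfderiv 𝓘(ℝ, Heis) 𝓘(ℝ, Heis) proj g v ∈ distribution X (proj g) ↔
      v ∈ distribution Heis.X g := by
  simp only [distribution, Submodule.mem_span_range_iff_exists_fun]
  exact exists_congr fun u =>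
    eq_comm.trans (mfderiv_proj_eq_sum_iff.trans eq_comm)

theorem frameNorm_mfderiv_proj (g : Heis) (v : TangentSpace 𝓘(ℝ, Heis) g) :
    frameNorm X (proj g) (mfderiv 𝓘(ℝ, Heis) 𝓘(ℝ, Heis) proj g v) = frameNorm Heis.X g v := by
  simp only [frameNorm, mfderiv_proj_eq_sum_iff]

theorem velocity_proj_comp {γ : ℝ → Heis} {r : ℝ}
    (h : MDifferentiableAt 𝓘(ℝ, ℝ) 𝓘(ℝ, Heis) γ r) :
    velocity (proj ∘ γ) r = mfderiv 𝓘(ℝ, Heis) 𝓘(ℝ, Heis) proj (γ r) (velocity γ r) := by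
  rw [velocity, mfderiv_comp r (mdifferentiableAt_proj (γ r)) h]
  rfl

theorem mdifferentiableAt_proj_comp_iff {γ : ℝ → Heis} {r : ℝ} (hc : ContinuousAt γ r) :
    MDifferentiableAt 𝓘(ℝ, ℝ) 𝓘(ℝ, Heis) (proj ∘ γ) r ↔
      MDifferentiableAt 𝓘(ℝ, ℝ) 𝓘(ℝ, Heis) γ r := by
  refine ⟨fun h => ?_, fun h => (mdifferentiableAt_proj (γ r)).comp r h⟩
  obtain ⟨σ, hσ, hs⟩ := exists_local_section (γ r)
  have h1 : MDifferentiableAt 𝓘(ℝ, ℝ) 𝓘(ℝ, Heis) (σ ∘ (proj ∘ γ)) r :=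
    MDifferentiableAt.comp r (I' := 𝓘(ℝ, Heis)) hσ h
  exact h1.congr_of_eventuallyEq ((hc.eventually hs).mono fun r' hr' => hr'.symm)

theorem isLipschitzCurve_proj_comp_iff {γ : ℝ → Heis} {s t : ℝ} (hc : ContinuousOn γ (Icc s t)) :
    IsLipschitzCurve Heis (proj ∘ γ) s t ↔ IsLipschitzCurve Heis γ s t := by
  have key : ∀ r ∈ Icc s t, ∃ h : Heis, ∀ᶠ r' in 𝓝[Icc s t] r,
      extChartAt 𝓘(ℝ, Heis) ((proj ∘ γ) r) ((proj ∘ γ) r') = h * γ r' := fun r hr => by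
    obtain ⟨h, hh⟩ := exists_chart_proj_eventuallyEq (γ r)
    exact ⟨h, (hc r hr).eventually hh⟩
  constructor
  · rintro ⟨-, hL⟩
    refine ⟨hc, fun r hr => ?_⟩
    obtain ⟨K, U, hU, hK⟩ := hL r hr
    obtain ⟨h, hh⟩ := key r hr
    obtain ⟨K', hK'⟩ := exists_lipschitzWith_mul_left h⁻¹
    refine ⟨K' * K, _, Filter.inter_mem hU hh, ?_⟩
    have h1 := hK'.comp_lipschitzOnWith (hK.mono (inter_subset_left (t :=
      {r' | extChartAt 𝓘(ℝ, Heis) ((proj ∘ γ) r) ((proj ∘ γ) r') = h * γ r'})))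
    intro x hx y hy
    have h2 := h1 hx hy
    simp only [Function.comp_def] at h2
    have hx2 := hx.2
    have hy2 := hy.2
    simp only [Function.comp_def, mem_ofPred_eq] at hx2 hy2
    rw [hx2, hy2, inv_mul_cancel_left, inv_mul_cancel_left] at h2
    exact h2
  · rintro ⟨-, hL⟩
    refine ⟨continuous_proj.comp_continuousOn hc, fun r hr => ?_⟩
    obtain ⟨K, U, hU, hK⟩ := hL r hr
    obtain ⟨h, hh⟩ := key r hr
    obtain ⟨K', hK'⟩ := exists_lipschitzWith_mul_left h
    refine ⟨K' * K, _, Filter.inter_mem hU hh, ?_⟩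
    intro x hx y hy
    have h2 := (hK'.comp_lipschitzOnWith hK) hx.1 hy.1
    have hx2 := hx.2
    have hy2 := hy.2
    simp only [mem_ofPred_eq] at hx2 hy2
    simp only [hx2, hy2]
    exact h2

/-- Continuity of `γ` is what lets local inverses of `proj` recover it from its projection; the
converse direction is applied to lifts. -/
theorem isHorizontal_proj_comp_iff {γ : ℝ → Heis} {s t : ℝ} (hc : ContinuousOn γ (Icc s t)) :
    IsHorizontal X (proj ∘ γ) s t ↔ IsHorizontal Heis.X γ s t := by
  have key : ∀ᵐ r ∂(volume.restrict (Icc s t)), ContinuousAt γ r := by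
    rw [← restrict_Ioo_eq_restrict_Icc]
    filter_upwards [ae_restrict_mem measurableSet_Ioo] with r hr
    exact hc.continuousAt (Icc_mem_nhds hr.1 hr.2)
  constructor
  · rintro ⟨h1, h2⟩
    refine ⟨(isLipschitzCurve_proj_comp_iff hc).1 h1, ?_⟩
    filter_upwards [key, h2] with r hr h
    have hd := (mdifferentiableAt_proj_comp_iff hr).1 h.1
    refine ⟨hd, mfderiv_proj_mem_distribution_iff.1 ?_⟩
    rw [← velocity_proj_comp hd]
    exact h.2
  · rintro ⟨h1, h2⟩
    refine ⟨(isLipschitzCurve_proj_comp_iff hc).2 h1, ?_⟩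
    filter_upwards [key, h2] with r hr h
    refine ⟨(mdifferentiableAt_proj_comp_iff hr).2 h.1, ?_⟩
    rw [velocity_proj_comp h.1]
    exact mfderiv_proj_mem_distribution_iff.2 h.2

theorem length_proj_comp {γ : ℝ → Heis} {s t : ℝ} (h : IsHorizontal Heis.X γ s t) :
    length X (proj ∘ γ) s t = length Heis.X γ s t := by
  refine lintegral_congr_ae (h.2.mono fun r hr => ?_)
  simp only [velocity_proj_comp hr.1]
  exact congrArg ENNReal.ofReal (frameNorm_mfderiv_proj _ _)

theorem dist_proj_le (p q : Heis) :
    SubRiemannian.dist X (proj p) (proj q) ≤ SubRiemannian.dist Heis.X p q := by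
  refine le_sInf ?_
  rintro _ ⟨γ, T, hT, hγ, rfl, rfl, rfl⟩
  rw [← length_proj_comp hγ]
  exact dist_le_length hT ((isHorizontal_proj_comp_iff hγ.1.1).2 hγ)

/-! ### Lifting curves and comparing minimizers -/

theorem isCoveringMap_proj : IsCoveringMap proj :=
  isQuotientCoveringMap_quotientMk_of_properlyDiscontinuousSMul.isCoveringMap

/-- A curve in the nil-manifold ending at `π(q)` lifts to a curve ending at `q`. -/
theorem exists_lift {γ : ℝ → NilManifold} {T : ℝ} (hT : 0 ≤ T) (hγ : ContinuousOn γ (Icc 0 T))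
    {q : Heis} (hq : γ T = proj q) :
    ∃ Γ : ℝ → Heis, Continuous Γ ∧ EqOn (proj ∘ Γ) γ (Icc 0 T) ∧ Γ T = q := by
  -- Path lifting prescribes the initial point, so the curve is traversed backwards in order to
  -- prescribe its end.
  let γ₀ : C(unitInterval, NilManifold) :=
    ⟨fun x => γ (T * (1 - (x : ℝ))), hγ.comp_continuous (by fun_prop) fun x =>
      ⟨mul_nonneg hT (by linarith [x.2.2]), mul_le_of_le_one_right hT (by linarith [x.2.1])⟩⟩
  have h0 : γ₀ 0 = proj q := by
    rw [← hq]
    simp [γ₀]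
  obtain ⟨Γ, h1, h2⟩ := isCoveringMap_proj.exists_path_lifts γ₀ q h0
  -- Undoing the rescaling divides by `T`, so `T = 0` is treated apart.
  rcases hT.eq_or_lt with rfl | hpos
  · refine ⟨fun _ => q, continuous_const, fun r hr => ?_, rfl⟩
    obtain rfl : r = 0 := le_antisymm hr.2 hr.1
    exact hq.symm
  · refine ⟨fun r => Γ (projIcc 0 1 zero_le_one (1 - r / T)), by fun_prop, fun r hr => ?_, ?_⟩
    · have hr' : 1 - r / T ∈ Icc (0 : ℝ) 1 :=
        ⟨sub_nonneg.2 ((div_le_one hpos).2 hr.2), sub_le_self _ (div_nonneg hr.1 hT)⟩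
      have h3 := congrFun h1 (projIcc 0 1 zero_le_one (1 - r / T))
      refine h3.trans ?_
      simp only [γ₀, ContinuousMap.coe_mk, projIcc_of_mem zero_le_one hr']
      congr 1
      field_simp
      ring
    · beta_reduce
      rw [div_self hpos.ne', sub_self, projIcc_left]
      exact h2

/-- The distance in the nil-manifold is at least the infimum of the distances of representatives. -/
theorem le_dist_proj {p q : Heis} {d : ℝ≥0∞}
    (h : ∀ h ∈ Heis.intSubgroup, d ≤ SubRiemannian.dist Heis.X (h * p) q) :
    d ≤ SubRiemannian.dist X (proj p) (proj q) := by
  refine le_sInf ?_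
  rintro _ ⟨γ, T, hT, hγ, h0, h1, rfl⟩
  obtain ⟨Γ, hc, he, hΓ⟩ := exists_lift hT hγ.1.1 h1
  have hΓh := (isHorizontal_proj_comp_iff hc.continuousOn).1 (hγ.congr he)
  rw [← length_congr he, length_proj_comp hΓh]
  refine le_trans ?_ (dist_le_length hT hΓh)
  -- The lift starts over `proj p`, hence at a translate of `p` by an element of `H`.
  obtain ⟨k, hk, hk'⟩ := proj_eq_iff.1 ((he ⟨le_rfl, hT⟩).trans h0)
  rw [← hk', hΓ]
  exact h k hk

/-- Minimizers of the nil-manifold are projections of minimizers. -/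
theorem isLengthMinimizer_of_proj_comp {γ : ℝ → Heis} {t : ℝ} (ht : 0 ≤ t)
    (hγ : IsHorizontal Heis.X γ 0 t) (h : IsLengthMinimizer X (proj ∘ γ) 0 t) :
    IsLengthMinimizer Heis.X γ 0 t := by
  refine ⟨hγ, le_antisymm ?_ (dist_le_length ht hγ)⟩
  rw [← length_proj_comp hγ, h.2]
  exact dist_proj_le _ _

/-- A minimizer from the identity of length less than `1 / 2` projects to a minimizer. -/
theorem isLengthMinimizer_proj_comp {γ : ℝ → Heis} {t : ℝ} (h0 : γ 0 = 1)
    (h : IsLengthMinimizer Heis.X γ 0 t) (hlen : length Heis.X γ 0 t < 1 / 2) :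
    IsLengthMinimizer X (proj ∘ γ) 0 t := by
  have hγ' := (isHorizontal_proj_comp_iff h.1.1.1).2 h.1
  refine ⟨hγ', ?_⟩
  rw [length_proj_comp h.1]
  refine le_antisymm (le_dist_proj fun k hk => ?_) ((dist_proj_le _ _).trans h.2.ge)
  by_cases hk1 : k = 1
  · rw [hk1, one_mul]
    exact h.2.le
  · have h1 := Heis.one_le_dist_add_dist (q := γ t) hk (one_mem _) hk1
    have h2 := h.2
    rw [h0] at h2 ⊢
    rw [mul_one]
    rw [← h2, ← ENNReal.add_halves 1] at h1
    by_contra! hlt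
    exact absurd h1 (not_le.2 (ENNReal.add_lt_add (hlt.trans hlen) hlen))

end NilManifold

/-! ### Comparison of the cut times -/

theorem mainTheorem11 :
    Heis.tHat = 1 / 2 ∧
    ∀ (J : Set ℝ) (g : ℝ → Heis), J.OrdConnected → IsLeast J 0 →
      SubRiemannian.IsGeodesic Heis.X g J → SubRiemannian.IsArcLength Heis.X g J → g 0 = 1 →
      SubRiemannian.cutTime NilManifold.X (NilManifold.proj ∘ g) J ≤
          SubRiemannian.cutTime Heis.X g J ∧
      (Heis.tHat ≤ SubRiemannian.cutTime Heis.X g J →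
        Heis.tHat ≤ SubRiemannian.cutTime NilManifold.X (NilManifold.proj ∘ g) J ∧
        SubRiemannian.cutTime NilManifold.X (NilManifold.proj ∘ g) J ≤
          SubRiemannian.cutTime Heis.X g J) ∧
      (SubRiemannian.cutTime Heis.X g J < Heis.tHat →
        SubRiemannian.cutTime NilManifold.X (NilManifold.proj ∘ g) J =
          SubRiemannian.cutTime Heis.X g J) := by
  refine ⟨Heis.tHat_eq, fun J g hJ h0 hg harc hg0 => ?_⟩
  have hlen : ∀ t ∈ J, SubRiemannian.length Heis.X g 0 t = ENNReal.ofReal t := fun t ht => by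
    rw [SubRiemannian.length_eq_of_isArcLength hJ h0.1 ht harc, sub_zero]
  have hle : SubRiemannian.cutTime NilManifold.X (NilManifold.proj ∘ g) J ≤
      SubRiemannian.cutTime Heis.X g J := by
    refine sSup_le_sSup ?_
    rintro _ ⟨t, ht, hpos, hmin, rfl⟩
    exact ⟨t, ht, hpos, NilManifold.isLengthMinimizer_of_proj_comp hpos.le
      (hg.1 0 h0.1 t ht hpos.le) hmin, rfl⟩
  have hproj : ∀ t ∈ J, 0 < t → ENNReal.ofReal t < 1 / 2 →
      SubRiemannian.IsLengthMinimizer Heis.X g 0 t →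
      ENNReal.ofReal t ≤ SubRiemannian.cutTime NilManifold.X (NilManifold.proj ∘ g) J :=
    fun t ht hpos hlt hmin => le_sSup ⟨t, ht, hpos,
      NilManifold.isLengthMinimizer_proj_comp hg0 hmin (by rwa [hlen t ht]), rfl⟩
  rw [Heis.tHat_eq]
  refine ⟨hle, fun hcut => ⟨le_of_forall_lt fun τ hτ => ?_, hle⟩, fun hcut => le_antisymm hle ?_⟩
  -- Some minimizing arc is longer than `τ'`; cut back to length `τ' < 1/2`, it still minimizes and
  -- so does its projection.
  · obtain ⟨τ', h1, h2⟩ := exists_between hτ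
    obtain ⟨_, ⟨t, ht, hpos, hmin, rfl⟩, hτt⟩ := lt_sSup_iff.1 (h2.trans_le hcut)
    have hτ' : ENNReal.ofReal τ'.toReal = τ' := ENNReal.ofReal_toReal h2.ne_top
    have hst : τ'.toReal ≤ t := ENNReal.toReal_le_of_le_ofReal hpos.le hτt.le
    have hs : 0 < τ'.toReal := ENNReal.toReal_pos (pos_of_gt h1).ne' h2.ne_top
    refine h1.trans_le ?_
    rw [← hτ']
    refine hproj _ (hJ.out h0.1 ht ⟨hs.le, hst⟩) hs (by rwa [hτ']) ?_
    exact Heis.isLengthMinimizer_of_le hs.le hst hmin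
      (by rw [hlen t ht]; exact ENNReal.ofReal_ne_top)
  · refine sSup_le ?_
    rintro _ ⟨t, ht, hpos, hmin, rfl⟩
    -- Every minimizing time is at most the cut time, hence below 1/2, so no truncation is needed.
    exact hproj t ht hpos ((le_sSup ⟨t, ht, hpos, hmin, rfl⟩ : _ ≤
      SubRiemannian.cutTime Heis.X g J).trans_lt hcut) hmin
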